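/- Let $X$ be a topological space and let $\mathcal B$ be a bornology on $X$, that is, a family of subsets of $X$ (called bounded sets) that contains all singletons and is closed under taking subsets and finite unions. The pair $(X,\mathcal B)$ is called a bornological universe. An isomorphism of bornological universes is a homeomorphism $h$ such that $h$ and $h^{-1}$ map bounded sets to bounded sets. The pair $(X,\mathcal B)$ is called uniformizable if there is a uniformity $\mathcal U$ on $X$ that induces the topology of $X$ and for which $\mathcal B$ consists exactly of the sets $B\subseteq X$ that are bounded in the sense of Bourbaki: for each $U\in\mathcal U$ there are $n\in\mathbb N$ and a finite set $K\subseteq X$ with $B\subseteq U^n(K)$. It is called Hausdorff if $X$ is Hausdorff. Let $\mathcal C_{\mathcal B}(X)$ be the set of continuous maps $f:X\to\mathbb R$ that are bounded on each $B\in\mathcal B$. For Tychonoff $X$ and $f\in\mathcal C_{\mathcal B}(X)$, let $f^\beta:\beta X\to\mathbb R\cup\{\infty\}$ be the continuous extension of $f$ to the Stone–Čech compactification, with values in the one-point compactification of $\mathbb R$, and put $\upsilon_{\mathcal B}(X)=\{x\in\beta X : f^\beta(x)\neq\infty \text{ for all } f\in\mathcal C_{\mathcal B}(X)\}$. The pair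 $(X,\mathcal B)$ is called realcompact if $X$ is Tychonoff and $\upsilon_{\mathcal B}(X)=X$. Proposition. A bornological universe $(X,\mathcal B)$ is Hausdorff, uniformizable and realcompact if and only if there are a set $\alpha$ and a closed subset $C$ of $\mathbb R^\alpha$ such that $(X,\mathcal B)$ is isomorphic to $C$, where $C$ carries the subspace topology of the product topology and the bornology of all sets $B\subseteq C$ for which every projection $\pi_i(B)\subseteq\mathbb R$, $i\in\alpha$, is bounded. -/

import Mathlib

open Set Topology Uniformity

/-! A *bornological universe* is a type `X` with `[TopologicalSpace X] [Bornology X]`, the two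
structures being unrelated. Products and subtypes carry Mathlib's instances: a subset of a product
is bounded iff all its projections are bounded, and a subset of a subtype is bounded iff it is
bounded in the ambient space. -/

universe u v

namespace BornUniverse

/-- The `n`-fold composite `U ∘ ⋯ ∘ U` of a relation on `X`; for `n = 0` it is the diagonal. -/
def relPow {X : Type u} (U : Set (X × X)) : ℕ → Set (X × X)
  | 0 => {p | p.1 = p.2}
  | n + 1 => {p | ∃ z, (p.1, z) ∈ relPow U n ∧ (z, p.2) ∈ U}

/-- `B` is bounded in the sense of Bourbaki: for each entourage `U` there are `n` and a finite
set `K` with `B ⊆ Uⁿ(K)`. -/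
def IsBourbakiBounded {X : Type u} [UniformSpace X] (B : Set X) : Prop :=
  ∀ U ∈ 𝓤 X, ∃ (n : ℕ) (K : Set X), K.Finite ∧ B ⊆ {y | ∃ x ∈ K, (x, y) ∈ relPow U n}

/-- The topology of `X` is induced by a uniformity whose Bourbaki-bounded sets are exactly the
bounded sets of `X`. -/
def IsUniformizable (X : Type u) [t : TopologicalSpace X] [Bornology X] : Prop :=
  ∃ 𝒰 : UniformSpace X, 𝒰.toTopologicalSpace = t ∧
    ∀ B : Set X, Bornology.IsBounded B ↔ @IsBourbakiBounded X 𝒰 B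

/-- The set of continuous real-valued maps on `X` that are bounded on every bounded set. -/
def boundedMaps (X : Type u) [TopologicalSpace X] [Bornology X] : Set C(X, ℝ) :=
  {f | ∀ B : Set X, Bornology.IsBounded B → Bornology.IsBounded (f '' B)}

/-- The extension `f^β : β(X) → ℝ ∪ {∞}` of a continuous map `f : X → ℝ` to the Stone–Čech
compactification, with values in the one-point compactification of `ℝ`. -/
noncomputable def betaExtend {X : Type u} [TopologicalSpace X] (f : C(X, ℝ)) :
    StoneCech X → OnePoint ℝ :=
  stoneCechExtend (g := fun x => ((f x : ℝ) : OnePoint ℝ))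
    (OnePoint.continuous_coe.comp f.continuous)

/-- `υ_𝓑(X)`, the set of points of `β(X)` at which no extension of a map that is bounded on the
bounded sets takes the value `∞`. -/
def upsilon (X : Type u) [TopologicalSpace X] [Bornology X] : Set (StoneCech X) :=
  {p | ∀ f ∈ boundedMaps X, betaExtend f p ≠ OnePoint.infty}

/-- `X` is Tychonoff and `υ_𝓑(X)` is equal to `X`, where `X` is regarded as a subspace
of `β(X)`. -/
def IsRealcompact (X : Type u) [TopologicalSpace X] [Bornology X] : Prop :=
  T35Space X ∧ upsilon X = range (stoneCechUnit : X → StoneCech X)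

/-- Isomorphisms of bornological universes: homeomorphisms that, together with their inverses,
map bounded sets to bounded sets. -/
structure Iso (X : Type u) (Y : Type v) [TopologicalSpace X] [Bornology X]
    [TopologicalSpace Y] [Bornology Y] extends X ≃ₜ Y where
  bounded_toFun : ∀ B : Set X, Bornology.IsBounded B → Bornology.IsBounded (toFun '' B)
  bounded_invFun : ∀ B : Set Y, Bornology.IsBounded B → Bornology.IsBounded (invFun '' B)

end BornUniverse

/-!
A Hausdorff, uniformizable and realcompact bornological universe embeds into a power of `ℝ` by the
family of *all* continuous maps that are bounded on bounded sets. Two points need an argument.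

* The image is closed: if `x ↦ (f x)_f` converges along an ultrafilter on `X`, then the limit `p` of
  that ultrafilter in `β(X)` satisfies `f^β(p) ≠ ∞` for all these `f`, so `p` lies in `X` by
  realcompactness. This shows that the map is proper (`isClosedEmbedding_evalBoundedMaps`).
* The bornology is the right one: a set on which all these maps are bounded is Bourbaki-bounded
  (`isBounded_of_forall_boundedMaps`). If `B` is not Bourbaki-bounded with respect to a symmetric
  entourage `V`, consider the classes of points joined by `V`-chains. Either `B` meets infinitely
  many classes, and some function that is constant on the classes is unbounded on `B`, or the
  number of `V`-steps from a fixed system of representatives is unbounded on `B`. In both cases there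
  is an `ℕ`-valued function `L`, unbounded on `B`, that changes by at most `1` along `V`
  (`isBourbakiBounded_of_forall_coarse`). Such an `L` is bounded on all Bourbaki-bounded sets, and
  it is at distance at most `1` from a continuous function, a locally finite sum of Urysohn
  functions of its sublevel sets (`exists_continuousMap_near_of_coarse`).

Conversely, a bounded subset of a closed `C ⊆ ℝ^ι` has compact closure, so it is totally bounded for
the uniformity induced on `C`, and the coordinates are uniformly continuous, so they are bounded on
Bourbaki-bounded sets. The coordinates are also bounded maps; where their extensions to `β(C)` are
finite, they determine a point of `ℝ^ι` in the closure of `C`, hence in `C`.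
-/

namespace BornUniverse

open Filter Bornology

/-! ### Powers of a relation -/

section relPow

variable {X : Type*} {U V : Set (X × X)} {x y z : X} {m n : ℕ}

lemma relPow_mono (h : U ⊆ V) (n : ℕ) : relPow U n ⊆ relPow V n := by
  induction n with
  | zero => exact subset_rfl
  | succ n ih =>
    rintro p ⟨z, hz, hp⟩
    exact ⟨z, ih hz, h hp⟩

lemma mem_relPow_one (h : (x, y) ∈ U) : (x, y) ∈ relPow U 1 := ⟨x, rfl, h⟩

lemma mem_relPow_add (hxy : (x, y) ∈ relPow U m) (hyz : (y, z) ∈ relPow U n) :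
    (x, z) ∈ relPow U (m + n) := by
  induction n generalizing z with
  | zero =>
    obtain rfl : y = z := hyz
    exact hxy
  | succ n ih =>
    obtain ⟨w, hw, hwz⟩ := hyz
    exact ⟨w, ih hw, hwz⟩

lemma mem_relPow_symm (hU : ∀ a b, (a, b) ∈ U → (b, a) ∈ U) (h : (x, y) ∈ relPow U n) :
    (y, x) ∈ relPow U n := by
  induction n generalizing y with
  | zero => exact Eq.symm h
  | succ n ih =>
    obtain ⟨w, hw, hwy⟩ := h
    rw [Nat.add_comm]
    exact mem_relPow_add (mem_relPow_one (hU _ _ hwy)) (ih hw)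

/-- The equivalence relation of being joined by a finite chain of `U`-steps. -/
def chainSetoid (U : Set (X × X)) (hU : ∀ a b, (a, b) ∈ U → (b, a) ∈ U) : Setoid X where
  r x y := ∃ n, (x, y) ∈ relPow U n
  iseqv :=
    { refl := fun _ => ⟨0, rfl⟩
      symm := fun ⟨n, h⟩ => ⟨n, mem_relPow_symm hU h⟩
      trans := fun ⟨m, h⟩ ⟨n, h'⟩ => ⟨m + n, mem_relPow_add h h'⟩ }

lemma abs_sub_le_of_mem_relPow {f : X → ℝ} (hf : ∀ a b, (a, b) ∈ U → |f a - f b| ≤ 1)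
    (h : (x, y) ∈ relPow U n) : |f x - f y| ≤ n := by
  induction n generalizing y with
  | zero =>
    obtain rfl : x = y := h
    simp
  | succ n ih =>
    obtain ⟨w, hw, hwy⟩ := h
    have := abs_sub_le (f x) (f w) (f y)
    push_cast
    linarith [ih hw, hf _ _ hwy]

end relPow

/-! ### Bourbaki-bounded sets and coarse functions -/

section Uniform

variable {X : Type*} [UniformSpace X] {B : Set X}

lemma IsBourbakiBounded.isBounded_image (hB : IsBourbakiBounded B) {U : Set (X × X)}
    (hU : U ∈ 𝓤 X) {f : X → ℝ} (hf : ∀ a b, (a, b) ∈ U → |f a - f b| ≤ 1) :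
    IsBounded (f '' B) := by
  obtain ⟨n, K, hK, hBK⟩ := hB U hU
  have : IsBounded (⋃ x ∈ K, Metric.closedBall (f x) n) :=
    (isBounded_biUnion hK).2 fun _ _ => Metric.isBounded_closedBall
  refine this.subset ?_
  rintro _ ⟨y, hy, rfl⟩
  obtain ⟨x, hx, hxy⟩ := hBK hy
  refine mem_iUnion₂.2 ⟨x, hx, ?_⟩
  rw [Metric.mem_closedBall, dist_comm, Real.dist_eq]
  exact abs_sub_le_of_mem_relPow hf hxy

lemma isBourbakiBounded_of_totallyBounded (hB : TotallyBounded B) : IsBourbakiBounded B := by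
  intro U hU
  obtain ⟨K, hK, hBK⟩ := hB _ (symm_le_uniformity hU)
  refine ⟨1, K, hK, fun y hy => ?_⟩
  obtain ⟨x, hx, hxy⟩ := mem_iUnion₂.1 (hBK hy)
  exact ⟨x, hx, mem_relPow_one hxy⟩

/-- A set is Bourbaki-bounded if every `ℕ`-valued function that changes by at most `1` along some
entourage is bounded on it. -/
lemma isBourbakiBounded_of_forall_coarse
    (h : ∀ V ∈ 𝓤 X, ∀ L : X → ℕ, (∀ x y, (x, y) ∈ V → L y ≤ L x + 1 ∧ L x ≤ L y + 1) →
      BddAbove (L '' B)) :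
    IsBourbakiBounded B := by
  classical
  intro U hU
  obtain ⟨V, hV, hVs, hVU⟩ := symm_of_uniformity hU
  have hVsymm (a b : X) (h : (a, b) ∈ V) : (b, a) ∈ V := hVs.symm _ _ h
  let s := chainSetoid V hVsymm
  let q : X → Quotient s := Quotient.mk s
  have hq {x y : X} (hxy : (x, y) ∈ V) : q x = q y := Quotient.sound ⟨1, mem_relPow_one hxy⟩
  -- A function of the chain class that is unbounded on an infinite set of classes shows that `B`
  -- meets only finitely many classes.
  have hfin : (q '' B).Finite := by
    by_contra hinf
    let w := Set.Infinite.natEmbedding _ hinf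
    have hw : Function.Injective fun n => (w n : Quotient s) :=
      Subtype.val_injective.comp w.injective
    let L : X → ℕ := fun x => Function.invFun (fun n => (w n : Quotient s)) (q x)
    obtain ⟨N, hN⟩ := h V hV L fun x y hxy => by simp [L, hq hxy]
    obtain ⟨x, hxB, hx⟩ := (w (N + 1)).2
    have hLx : L x = N + 1 := by
      simp only [L, hx]
      exact Function.leftInverse_invFun hw (N + 1)
    have := hN ⟨x, hxB, rfl⟩
    omega
  -- The number of steps from the representative of the chain class.
  have hreach (x : X) : ∃ n, ((q x).out, x) ∈ relPow V n := Quotient.mk_out (s := s) x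
  let L : X → ℕ := fun x => Nat.find (hreach x)
  have hL {x y : X} (hxy : (x, y) ∈ V) : L y ≤ L x + 1 :=
    Nat.find_min' (hreach y) ⟨x, hq hxy ▸ Nat.find_spec (hreach x), hxy⟩
  obtain ⟨N, hN⟩ := h V hV L fun x y hxy => ⟨hL hxy, hL (hVsymm _ _ hxy)⟩
  refine ⟨N, Quotient.out '' (q '' B), hfin.image _, fun y hy =>
    ⟨_, mem_image_of_mem _ (mem_image_of_mem _ hy), relPow_mono hVU N ?_⟩⟩
  -- A chain may be prolonged by trivial steps, since `V` is reflexive.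
  have hmono : Monotone (relPow V) :=
    monotone_nat_of_le_succ fun n p hp => ⟨p.2, hp, refl_mem_uniformity hV⟩
  exact hmono (hN ⟨y, hy, rfl⟩) (Nat.find_spec (hreach y))

/-- Urysohn's lemma in a uniform space, for a set and the complement of a uniform
neighbourhood of it. -/
lemma exists_continuous_zero_one_of_mem_uniformity (A : Set X) {V : Set (X × X)} (hV : V ∈ 𝓤 X) :
    ∃ g : X → ℝ, Continuous g ∧ (∀ x, g x ∈ Icc (0 : ℝ) 1) ∧ (∀ x ∈ A, g x = 0) ∧
      ∀ y, (∀ x ∈ A, (x, y) ∉ V) → g y = 1 := by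
  let T : Set (X × X) → Set X → Set X := fun W c => {y | ∃ x ∈ c, (x, y) ∈ W}
  have hTopen {W : Set (X × X)} (hW : IsOpen W) (c : Set X) : IsOpen (T W c) := by
    have : T W c = ⋃ x ∈ c, UniformSpace.ball x W := by
      ext y; simp [T, UniformSpace.ball]
    rw [this]
    exact isOpen_biUnion fun x _ => UniformSpace.isOpen_ball x hW
  have hsub {W : Set (X × X)} (hW : W ∈ 𝓤 X) (c : Set X) : c ⊆ T W c :=
    fun x hx => ⟨x, hx, refl_mem_uniformity hW⟩
  have hclosure {W : Set (X × X)} (hW : W ∈ 𝓤 X) (hWs : ∀ a b, (a, b) ∈ W → (b, a) ∈ W)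
      {c : Set X} {y : X} (hy : y ∈ closure c) : ∃ x ∈ c, (x, y) ∈ W := by
    obtain ⟨x, hxy, hx⟩ := mem_closure_iff_nhds.1 hy _ (UniformSpace.ball_mem_nhds y hW)
    exact ⟨x, hx, hWs _ _ hxy⟩
  have hsplit {W : Set (X × X)} (hW : W ∈ 𝓤 X) : ∃ S ∈ 𝓤 X, IsOpen S ∧
      (∀ a b, (a, b) ∈ S → (b, a) ∈ S) ∧
      ∀ a b c, (a, b) ∈ S → (b, c) ∈ S → (a, c) ∈ W := by
    obtain ⟨S, hS, hSo, hSs, hSW⟩ := comp_open_symm_mem_uniformity_sets hW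
    exact ⟨S, hS, hSo, fun a b h => hSs.symm _ _ h, fun a b c h h' => hSW ⟨b, h, h'⟩⟩
  obtain ⟨S, hS, -, hSs, hSV⟩ := hsplit (interior_mem_uniformity hV)
  let c : Urysohns.CU (fun c u : Set X => ∃ W ∈ 𝓤 X, T W c ⊆ u) :=
    { C := closure A
      U := T (interior V) A
      closed_C := isClosed_closure
      open_U := hTopen isOpen_interior A
      subset := fun y hy => by
        obtain ⟨x, hx, hxy⟩ := hclosure hS hSs hy
        exact ⟨x, hx, hSV _ _ _ hxy (refl_mem_uniformity hS)⟩
      P_C_U := ⟨S, hS, by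
        rintro b ⟨y, hy, hyb⟩
        obtain ⟨a, ha, hay⟩ := hclosure hS hSs hy
        exact ⟨a, ha, hSV _ _ _ hay hyb⟩⟩
      hP := by
        rintro c u - ⟨W, hW, hWu⟩ - -
        obtain ⟨S₁, hS₁, -, -, hS₁W⟩ := hsplit hW
        obtain ⟨S, hS, hSo, hSs, hSS₁⟩ := hsplit hS₁
        have key : T S (closure (T S c)) ⊆ u := by
          rintro b ⟨y, hy, hyb⟩
          obtain ⟨z, ⟨a, ha, haz⟩, hzy⟩ := hclosure hS hSs hy
          exact hWu ⟨a, ha, hS₁W _ _ _ (hSS₁ _ _ _ haz hzy)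
            (hSS₁ _ _ _ hyb (refl_mem_uniformity hS))⟩
        exact ⟨T S c, hTopen hSo c, hsub hS c, (hsub hS _).trans key, ⟨S, hS, subset_rfl⟩,
          ⟨S, hS, key⟩⟩ }
  refine ⟨c.lim, c.continuous_lim, c.lim_mem_Icc, fun x hx => c.lim_of_mem_C x
    (subset_closure hx), fun y hy => c.lim_of_notMem_U y ?_⟩
  rintro ⟨x, hx, hxy⟩
  exact hy x hx (interior_subset hxy)

lemma exists_continuousMap_near_of_coarse {V : Set (X × X)} (hV : V ∈ 𝓤 X) {L : X → ℕ}
    (hL : ∀ x y, (x, y) ∈ V → L y ≤ L x + 1) :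
    ∃ f : C(X, ℝ), ∀ x, |f x - L x| ≤ 1 := by
  choose g hgc hgI hg0 hg1 using fun n : ℕ =>
    exists_continuous_zero_one_of_mem_uniformity {x | L x ≤ n} hV
  have hg1' {n : ℕ} {x : X} (h : n + 1 < L x) : g n x = 1 := by
    refine hg1 n x fun y hy hyx => ?_
    have := hL _ _ hyx
    simp only [mem_ofPred_eq] at hy
    omega
  -- The terms with `L x ≤ n` vanish, so that the sum may be extended to any longer range.
  have hsum {x : X} {N : ℕ} (h : L x ≤ N) :
      ∑ n ∈ Finset.range (L x), g n x = ∑ n ∈ Finset.range N, g n x :=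
    Finset.sum_subset (Finset.range_mono h) fun n _ hn =>
      hg0 n x (by simpa using hn)
  refine ⟨⟨fun x => ∑ n ∈ Finset.range (L x), g n x, ?_⟩, fun x => ?_⟩
  · refine continuous_iff_continuousAt.2 fun x => ?_
    have hc : ContinuousAt (fun y => ∑ n ∈ Finset.range (L x + 1), g n y) x :=
      (continuous_finsetSum _ fun n _ => hgc n).continuousAt
    refine hc.congr ?_
    filter_upwards [UniformSpace.ball_mem_nhds x hV] with y hy
    exact (hsum (hL x y hy)).symm
  · have hle : ∑ n ∈ Finset.range (L x), g n x ≤ L x := by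
      simpa using Finset.sum_le_sum fun n (_ : n ∈ Finset.range (L x)) => (hgI n x).2
    have hge : (L x : ℝ) - 1 ≤ ∑ n ∈ Finset.range (L x), g n x := by
      rcases hLx : L x with _ | m
      · simp
      · have : ∑ n ∈ Finset.range m, g n x = m := by
          refine (Finset.sum_congr rfl fun n hn => hg1' ?_).trans (by simp)
          rw [Finset.mem_range] at hn
          omega
        rw [Finset.sum_range_succ, this]
        push_cast
        linarith [(hgI m x).1]
    simp only [ContinuousMap.coe_mk]
    rw [abs_le]
    constructor <;> linarith

end Uniform

lemma isBounded_of_forall_boundedMaps {X : Type*} [TopologicalSpace X] [Bornology X]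
    (hX : IsUniformizable X) {B : Set X} (hB : ∀ f ∈ boundedMaps X, IsBounded (f '' B)) :
    IsBounded B := by
  obtain ⟨𝒰, rfl, h𝒰⟩ := hX
  refine (h𝒰 B).2 (isBourbakiBounded_of_forall_coarse fun V hV L hL => ?_)
  obtain ⟨f, hf⟩ := exists_continuousMap_near_of_coarse hV fun x y hxy => (hL x y hxy).1
  have hfm : f ∈ boundedMaps X := by
    intro B' hB'
    have hLB' := ((h𝒰 B').1 hB').isBounded_image hV (f := fun x => (L x : ℝ)) fun x y hxy => by
      have h₁ : (L y : ℝ) ≤ L x + 1 := mod_cast (hL x y hxy).1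
      have h₂ : (L x : ℝ) ≤ L y + 1 := mod_cast (hL x y hxy).2
      rw [abs_le]
      constructor <;> linarith
    refine (hLB'.cthickening (δ := 1)).subset ?_
    rintro _ ⟨x, hx, rfl⟩
    exact Metric.mem_cthickening_of_dist_le _ (L x : ℝ) _ _ ⟨x, hx, rfl⟩ (hf x)
  obtain ⟨M, hM⟩ := (hB f hfm).bddAbove
  refine ⟨⌈M + 1⌉₊, ?_⟩
  rintro _ ⟨x, hx, rfl⟩
  have h₁ := hM ⟨x, hx, rfl⟩
  have h₂ := (abs_le.1 (hf x)).1
  exact_mod_cast (show (L x : ℝ) ≤ M + 1 by linarith).trans (Nat.le_ceil _)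

/-! ### The embedding by bounded maps -/

lemma betaExtend_stoneCechUnit {X : Type*} [TopologicalSpace X] (f : C(X, ℝ)) (x : X) :
    betaExtend f (stoneCechUnit x) = (f x : OnePoint ℝ) :=
  stoneCechExtend_stoneCechUnit _ x

lemma tendsto_betaExtend {X : Type*} [TopologicalSpace X] (f : C(X, ℝ)) {l : Filter X}
    {p : StoneCech X} (h : Tendsto stoneCechUnit l (𝓝 p)) :
    Tendsto (fun x => (f x : OnePoint ℝ)) l (𝓝 (betaExtend f p)) := by
  have hc : Continuous (betaExtend f) := continuous_stoneCechExtend _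
  simpa only [Function.comp_def, betaExtend_stoneCechUnit] using (hc.tendsto p).comp h

/-- The map `X → ℝ^{𝒞_𝓑(X)}` whose coordinates are all the bounded maps. -/
def evalBoundedMaps (X : Type*) [TopologicalSpace X] [Bornology X] (x : X) :
    boundedMaps X → ℝ :=
  fun f => f.1 x

lemma isClosedEmbedding_evalBoundedMaps {X : Type*} [TopologicalSpace X] [Bornology X]
    (hX : IsRealcompact X) : IsClosedEmbedding (evalBoundedMaps X) := by
  obtain ⟨_, hυ⟩ := hX
  have hcont : Continuous (evalBoundedMaps X) := continuous_pi fun f => f.1.continuous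
  have hinj : Function.Injective (evalBoundedMaps X) := by
    intro x y hxy
    by_contra hne
    obtain ⟨f, hfc, hfxy⟩ := separatesPoints_continuous_of_t35Space_Icc hne
    have hfm : (⟨fun x => (f x : ℝ), continuous_subtype_val.comp hfc⟩ : C(X, ℝ)) ∈
        boundedMaps X := fun B _ => by
      refine (Metric.isBounded_Icc (0 : ℝ) 1).subset ?_
      rintro _ ⟨x, -, rfl⟩
      exact (f x).2
    exact hfxy (Subtype.ext (congrFun hxy ⟨_, hfm⟩))
  have hproper : IsProperMap (evalBoundedMaps X) := by
    refine isProperMap_iff_ultrafilter.2 ⟨hcont, fun l r hl => ?_⟩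
    obtain ⟨p, -, hp⟩ := isCompact_univ.ultrafilter_le_nhds
      (l.map (stoneCechUnit : X → StoneCech X)) (by simp)
    have hp' : Tendsto stoneCechUnit (l : Filter X) (𝓝 p) := hp
    have hpυ : p ∈ upsilon X := fun f hf => by
      have h₁ : Tendsto (fun x => (f x : OnePoint ℝ)) l (𝓝 (r ⟨f, hf⟩ : OnePoint ℝ)) :=
        (OnePoint.continuous_coe.tendsto _).comp (tendsto_pi_nhds.1 hl ⟨f, hf⟩)
      rw [tendsto_nhds_unique (tendsto_betaExtend f hp') h₁]
      exact OnePoint.coe_ne_infty _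
    obtain ⟨x, rfl⟩ := hυ ▸ hpυ
    have hx : (l : Filter X) ≤ 𝓝 x := isInducing_stoneCechUnit.tendsto_nhds_iff.2 hp'
    exact ⟨x, tendsto_nhds_unique ((hcont.tendsto x).mono_left hx) hl, hx⟩
  exact .of_continuous_injective_isClosedMap hcont hinj hproper.isClosedMap

lemma isBounded_image_evalBoundedMaps_iff {X : Type*} [TopologicalSpace X] [Bornology X]
    (hX : IsUniformizable X) (B : Set X) : IsBounded (evalBoundedMaps X '' B) ↔ IsBounded B := by
  rw [← forall_isBounded_image_eval_iff]
  simp only [image_image]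
  exact ⟨fun h => isBounded_of_forall_boundedMaps hX fun f hf => h ⟨f, hf⟩,
    fun h f => f.2 B h⟩

/-! ### Closed subspaces of powers of `ℝ` -/

section ClosedEmbedding

variable {X ι : Type*} [TopologicalSpace X] [Bornology X] {e : X → ι → ℝ}

lemma isUniformizable_of_isClosedEmbedding (he : IsClosedEmbedding e)
    (hb : ∀ B, IsBounded (e '' B) ↔ IsBounded B) : IsUniformizable X := by
  refine ⟨UniformSpace.comap e inferInstance, he.isInducing.eq_induced.symm, fun B => ?_⟩
  let 𝒰 : UniformSpace X := UniformSpace.comap e inferInstance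
  have hu : IsUniformInducing e := ⟨rfl⟩
  rw [← hb]
  refine ⟨fun h => isBourbakiBounded_of_totallyBounded ?_, fun h => ?_⟩
  · rw [← totallyBounded_image_iff hu]
    have hc : IsCompact (univ.pi fun i => closure (Function.eval i '' (e '' B))) :=
      isCompact_univ_pi fun i => (forall_isBounded_image_eval_iff.2 h i).isCompact_closure
    refine TotallyBounded.subset ?_ hc.totallyBounded
    exact fun y hy i _ => subset_closure (mem_image_of_mem (Function.eval i) hy)
  · refine forall_isBounded_image_eval_iff.1 fun i => ?_
    have hui : UniformContinuous fun x => e x i :=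
      (Pi.uniformContinuous_proj (fun _ : ι => ℝ) i).comp hu.uniformContinuous
    rw [image_image]
    refine h.isBounded_image (hui (Metric.dist_mem_uniformity one_pos)) fun a b hab => le_of_lt ?_
    exact hab

lemma isRealcompact_of_isClosedEmbedding (he : IsClosedEmbedding e)
    (hb : ∀ B, IsBounded (e '' B) ↔ IsBounded B) : IsRealcompact X := by
  refine ⟨he.isEmbedding.t35Space, Subset.antisymm (fun p hp => ?_) ?_⟩
  · let coord (i : ι) : C(X, ℝ) := ⟨fun x => e x i, (continuous_apply i).comp he.continuous⟩
    have hcoord (i : ι) : coord i ∈ boundedMaps X := fun B hB => by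
      have := forall_isBounded_image_eval_iff.2 ((hb B).2 hB) i
      rwa [image_image] at this
    choose r hr using fun i => OnePoint.ne_infty_iff_exists.1 (hp _ (hcoord i))
    let l : Filter X := comap stoneCechUnit (𝓝 p)
    have hl : Tendsto stoneCechUnit l (𝓝 p) := tendsto_comap
    have : l.NeBot := comap_neBot_iff_frequently.2
      (mem_closure_iff_frequently.1 (denseRange_stoneCechUnit p))
    have her : Tendsto e l (𝓝 r) := tendsto_pi_nhds.2 fun i =>
      OnePoint.isOpenEmbedding_coe.isInducing.tendsto_nhds_iff.2
        (hr i ▸ tendsto_betaExtend (coord i) hl)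
    obtain ⟨x, rfl⟩ : r ∈ range e :=
      he.isClosed_range.mem_of_tendsto her (Eventually.of_forall mem_range_self)
    have hlx : Tendsto id l (𝓝 x) := he.isInducing.tendsto_nhds_iff.2 her
    exact ⟨x, tendsto_nhds_unique ((continuous_stoneCechUnit.tendsto x).comp hlx) hl⟩
  · rintro _ ⟨x, rfl⟩ f -
    rw [betaExtend_stoneCechUnit]
    exact OnePoint.coe_ne_infty _

end ClosedEmbedding

lemma nonempty_iso_range {X : Type*} {Y : Type*} [TopologicalSpace X] [Bornology X]
    [TopologicalSpace Y] [Bornology Y] {e : X → Y} (he : IsEmbedding e)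
    (hb : ∀ B, IsBounded (e '' B) ↔ IsBounded B) : Nonempty (Iso X (range e)) := by
  have hval (B : Set X) : Subtype.val '' (he.toHomeomorph '' B) = e '' B := by
    simp [image_image]
  refine ⟨⟨he.toHomeomorph, fun B hB => ?_, fun B hB => ?_⟩⟩
  · rw [← isBounded_image_subtype_val]
    exact (hval B).symm ▸ (hb B).2 hB
  · change IsBounded (he.toHomeomorph.symm '' B)
    rw [← hb, ← hval, isBounded_image_subtype_val]
    simpa [image_image] using hB

lemma Iso.isBounded_image_iff {X Y : Type*} [TopologicalSpace X] [Bornology X]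
    [TopologicalSpace Y] [Bornology Y] (h : Iso X Y) (B : Set X) :
    IsBounded (h.toHomeomorph '' B) ↔ IsBounded B := by
  refine ⟨fun hB => ?_, h.bounded_toFun B⟩
  have : IsBounded (h.toHomeomorph.symm '' (h.toHomeomorph '' B)) := h.bounded_invFun _ hB
  simpa [image_image] using this

end BornUniverse

theorem mainTheorem9 (X : Type u) [TopologicalSpace X] [Bornology X] :
    (T2Space X ∧ BornUniverse.IsUniformizable X ∧ BornUniverse.IsRealcompact X) ↔
      ∃ (ι : Type u) (C : Set (ι → ℝ)), IsClosed C ∧ Nonempty (BornUniverse.Iso X C) := by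
  constructor
  · rintro ⟨-, hu, hr⟩
    have he := BornUniverse.isClosedEmbedding_evalBoundedMaps hr
    exact ⟨_, _, he.isClosed_range,
      BornUniverse.nonempty_iso_range he.isEmbedding
        (BornUniverse.isBounded_image_evalBoundedMaps_iff hu)⟩
  · rintro ⟨ι, C, hC, ⟨h⟩⟩
    let e : X → ι → ℝ := fun x => h.toHomeomorph x
    have he : IsClosedEmbedding e := hC.isClosedEmbedding_subtypeVal.comp
      h.toHomeomorph.isClosedEmbedding
    have hb (B : Set X) : Bornology.IsBounded (e '' B) ↔ Bornology.IsBounded B := by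
      rw [← h.isBounded_image_iff, ← Bornology.isBounded_image_subtype_val, image_image]
    exact ⟨he.isEmbedding.t2Space, BornUniverse.isUniformizable_of_isClosedEmbedding he hb,
      BornUniverse.isRealcompact_of_isClosedEmbedding he hb⟩
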